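/- Let $$D(u)=6\left(u-\tfrac{7}{12}\right)\left(u-\tfrac34\right),\qquad F(u)=2u^3-4u^2+\tfrac{21}{8}u,\qquad R(u)=5u(1-u)\left(u-\tfrac15\right),$$ so that $F'=D$. Let $\varepsilon>0$ and $c\in\mathbb R$, and let $(\bar U,\bar W,\bar P,\bar V):\mathbb R\to\mathbb R^4$ be a solution of the travelling wave system $$\varepsilon \dot{\bar U}=\bar W,\qquad \varepsilon\dot{\bar W}=F(\bar U)-\bar V,\qquad \dot{\bar P}=-R(\bar U),\qquad \dot{\bar V}=\bar P-c\bar U$$ of the regularised reaction–nonlinear-diffusion equation $U_t=(D(U)U_x)_x+R(U)-\varepsilon^2U_{xxxx}$, where $\zeta=x-ct$ and the dot is $d/d\zeta$. Suppose that it is a heteroclinic orbit with limit $(1,0,c,F(1))$ as $\zeta\to-\infty$ and limit $(0,0,0,0)$ as $\zeta\to+\infty$; the shock-fronted travelling waves are of this form. Let $\mathcal L$ be the linearisation about the wave in the moving frame, $$\mathcal L U=cU_\zeta+(D(\bar U)U)_{\zeta\zeta}+R'(\bar U)U-\varepsilon^2U_{\zeta\zeta\zeta\zeta},$$ regarded as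 an unbounded operator on $L^2(\mathbb R;\mathbb C)$ with domain $H^4(\mathbb R;\mathbb C)$. Its spectrum $\sigma(\mathcal L)$ is the set of $\lambda\in\mathbb C$ for which $\lambda-\mathcal L$ has no bounded inverse defined on all of $L^2(\mathbb R;\mathbb C)$. Then there are constants $M>0$ and $0<\gamma<\pi/2$ such that every $\lambda\in\mathbb C$ with $|\lambda|>M$ and $|\arg\lambda|<\pi-\gamma$ (where $-\pi<\arg\lambda\le\pi$) satisfies $\lambda\notin\sigma(\mathcal L)$. Moreover, $\mathcal L$ is sectorial: it is closed and densely defined, and there are $a\in\mathbb R$, $0<\varphi<\pi/2$ and $C>0$ such that every $\lambda\ne a$ with $|\arg(\lambda-a)|\le\pi-\varphi$ lies in the resolvent set of $\mathcal L$ and satisfies $\|(\lambda-\mathcal L)^{-1}\|\le C/|\lambda-a|$. -/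

import Mathlib

open Filter Topology MeasureTheory
open scoped SchwartzMap

namespace ShockWave

noncomputable section

/-! ### Reaction, diffusion, and the travelling wave -/

/-- The nonlinear diffusivity `D(u) = 6 (u - 7/12) (u - 3/4)`. -/
def diffusion (u : ℝ) : ℝ := 6 * (u - 7 / 12) * (u - 3 / 4)

/-- The potential `F(u) = 2 u³ - 4 u² + (21/8) u`, an antiderivative of `D`. -/
def potential (u : ℝ) : ℝ := 2 * u ^ 3 - 4 * u ^ 2 + 21 / 8 * u

/-- The bistable reaction term `R(u) = 5 u (1 - u) (u - 1/5)`. -/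
def reaction (u : ℝ) : ℝ := 5 * u * (1 - u) * (u - 1 / 5)

theorem hasDerivAt_potential (u : ℝ) : HasDerivAt potential (diffusion u) u := by
  have h := (((hasDerivAt_pow 3 u).const_mul 2).sub ((hasDerivAt_pow 2 u).const_mul 4)).add
    ((hasDerivAt_id u).const_mul (21 / 8 : ℝ))
  refine h.congr_deriv ?_
  simp only [diffusion]
  norm_num
  ring

/-- `(U, W, P, V)` is a heteroclinic orbit, from `(1, 0, c, F(1))` at `-∞` to the origin at `+∞`,
of the travelling wave system `ε U' = W`, `ε W' = F(U) - V`, `P' = -R(U)`, `V' = P - c U`. -/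
structure IsHeteroclinicWave (ε c : ℝ) (U W P V : ℝ → ℝ) : Prop where
  ode_U : ∀ ζ, HasDerivAt U (W ζ / ε) ζ
  ode_W : ∀ ζ, HasDerivAt W ((potential (U ζ) - V ζ) / ε) ζ
  ode_P : ∀ ζ, HasDerivAt P (-reaction (U ζ)) ζ
  ode_V : ∀ ζ, HasDerivAt V (P ζ - c * U ζ) ζ
  tendsto_atBot :
    Tendsto (fun ζ ↦ (U ζ, W ζ, P ζ, V ζ)) atBot (𝓝 (1, 0, c, potential 1))
  tendsto_atTop :
    Tendsto (fun ζ ↦ (U ζ, W ζ, P ζ, V ζ)) atTop (𝓝 (0, 0, 0, 0))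

/-! ### The linearised operator on `L²(ℝ; ℂ)` -/

/-- The complex Hilbert space `L²(ℝ; ℂ)`. -/
abbrev L2 : Type := Lp ℂ 2 (volume : Measure ℝ)

/-- The tempered distribution defined by an `L²` function. -/
abbrev toDist (u : L2) : 𝓢'(ℝ, ℂ) := Lp.toTemperedDistributionCLM ℂ volume 2 u

/-- The derivative of tempered distributions on the line. -/
abbrev ddx : 𝓢'(ℝ, ℂ) →L[ℂ] 𝓢'(ℝ, ℂ) := TemperedDistribution.derivCLM ℂ

theorem smul_zero_distribution (a : ℂ) : a • (0 : 𝓢'(ℝ, ℂ)) = 0 := by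
  ext1 g
  exact smul_zero a

/-- The graph of `u ↦ c u' + (D(U) u)'' + R'(U) u - ε² u''''`, where `U` is the wave profile: the
pairs `(u, f)` with `u ∈ H⁴(ℝ; ℂ)`, `f ∈ L²(ℝ; ℂ)` and `f` equal to that expression in the sense
of distributions. Here `q` and `r` are the products `D(U) u` and `R'(U) u`, which lie in `L²`
because `U` is bounded. If `U` is smooth and its derivatives are bounded, as is the case for a
travelling wave, then every `u ∈ H⁴` is the first component of such a pair. -/
def linearisedGraph (ε c : ℝ) (U : ℝ → ℝ) : Submodule ℂ (L2 × L2) where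
  carrier := {p | TemperedDistribution.MemSobolev 4 2 (toDist p.1) ∧
    ∃ q r : L2,
      (∀ᵐ ζ : ℝ, q ζ = (diffusion (U ζ) : ℂ) * p.1 ζ) ∧
      (∀ᵐ ζ : ℝ, r ζ = ((deriv reaction (U ζ) : ℝ) : ℂ) * p.1 ζ) ∧
      toDist p.2 = (c : ℂ) • ddx (toDist p.1) + ddx (ddx (toDist q)) + toDist r
        - (ε ^ 2 : ℂ) • ddx (ddx (ddx (ddx (toDist p.1))))}
  add_mem' := by
    rintro ⟨u, f⟩ ⟨v, g⟩ ⟨hu, q, r, hq, hr, hf⟩ ⟨hv, q', r', hq', hr', hg⟩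
    refine ⟨?_, q + q', r + r', ?_, ?_, ?_⟩
    · simpa only [toDist, Prod.fst_add, map_add] using hu.add hv
    · filter_upwards [hq, hq', Lp.coeFn_add q q', Lp.coeFn_add u v] with x h1 h2 h3 h4
      simp only [Prod.fst_add, h3, h4, Pi.add_apply, h1, h2]
      ring
    · filter_upwards [hr, hr', Lp.coeFn_add r r', Lp.coeFn_add u v] with x h1 h2 h3 h4
      simp only [Prod.fst_add, h3, h4, Pi.add_apply, h1, h2]
      ring
    · simp only [toDist, Prod.fst_add, Prod.snd_add, map_add, smul_add] at hf hg ⊢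
      rw [hf, hg]
      abel
  zero_mem' := by
    refine ⟨?_, 0, 0, ?_, ?_, ?_⟩
    · simpa only [toDist, Prod.fst_zero, map_zero] using
        TemperedDistribution.memSobolev_fun_zero (E := ℝ) (F := ℂ) 4 2
    · filter_upwards [Lp.coeFn_zero ℂ 2 (volume : Measure ℝ)] with x h1
      simp only [Prod.fst_zero, h1, Pi.zero_apply, mul_zero]
    · filter_upwards [Lp.coeFn_zero ℂ 2 (volume : Measure ℝ)] with x h1
      simp only [Prod.fst_zero, h1, Pi.zero_apply, mul_zero]
    · simp only [toDist, Prod.fst_zero, Prod.snd_zero, map_zero, add_zero]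
      exact (by rw [smul_zero_distribution, smul_zero_distribution, sub_zero] :
        (0 : 𝓢'(ℝ, ℂ)) = (c : ℂ) • (0 : 𝓢'(ℝ, ℂ)) - (ε ^ 2 : ℂ) • (0 : 𝓢'(ℝ, ℂ)))
  smul_mem' := by
    rintro a ⟨u, f⟩ ⟨hu, q, r, hq, hr, hf⟩
    refine ⟨?_, a • q, a • r, ?_, ?_, ?_⟩
    · simpa only [toDist, Prod.smul_fst, map_smul] using hu.smul a
    · filter_upwards [hq, Lp.coeFn_smul a q, Lp.coeFn_smul a u] with x h1 h2 h3
      simp only [Prod.smul_fst, h2, h3, Pi.smul_apply, h1, smul_eq_mul]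
      ring
    · filter_upwards [hr, Lp.coeFn_smul a r, Lp.coeFn_smul a u] with x h1 h2 h3
      simp only [Prod.smul_fst, h2, h3, Pi.smul_apply, h1, smul_eq_mul]
      ring
    · simp only [toDist, Prod.smul_fst, Prod.smul_snd, map_smul] at hf ⊢
      rw [hf, smul_sub, smul_add, smul_add, smul_comm a (c : ℂ), smul_comm a (ε ^ 2 : ℂ)]

theorem linearisedGraph_functional (ε c : ℝ) (U : ℝ → ℝ) (p : L2 × L2)
    (hp : p ∈ linearisedGraph ε c U) (h0 : p.1 = 0) : p.2 = 0 := by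
  obtain ⟨u, f⟩ := p
  obtain ⟨-, q, r, hq, hr, hf⟩ : (u, f) ∈ (linearisedGraph ε c U).carrier := hp
  simp only at h0 hq hr hf
  subst h0
  have hq0 : q = 0 := by
    apply Lp.ext
    filter_upwards [hq, Lp.coeFn_zero ℂ 2 (volume : Measure ℝ)] with x h1 h2
    simp only [h1, h2, Pi.zero_apply, mul_zero]
  have hr0 : r = 0 := by
    apply Lp.ext
    filter_upwards [hr, Lp.coeFn_zero ℂ 2 (volume : Measure ℝ)] with x h1 h2
    simp only [h1, h2, Pi.zero_apply, mul_zero]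
  subst hq0 hr0
  simp only [toDist, map_zero, add_zero] at hf
  replace hf : Lp.toTemperedDistributionCLM ℂ (volume : Measure ℝ) 2 f = 0 :=
    hf.trans (by rw [smul_zero_distribution, smul_zero_distribution, sub_zero] :
      (c : ℂ) • (0 : 𝓢'(ℝ, ℂ)) - (ε ^ 2 : ℂ) • (0 : 𝓢'(ℝ, ℂ)) = 0)
  have h := Lp.ker_toTemperedDistributionCLM_eq_bot (F := ℂ) (μ := (volume : Measure ℝ)) (p := 2)
  exact (LinearMap.ker_eq_bot'.1 h) f hf

/-- The linearisation `L u = c u' + (D(U) u)'' + R'(U) u - ε² u''''` about the profile `U`, as an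
unbounded operator on `L²(ℝ; ℂ)`. -/
def linearisedOperator (ε c : ℝ) (U : ℝ → ℝ) : L2 →ₗ.[ℂ] L2 :=
  (linearisedGraph ε c U).toLinearPMap

theorem linearisedOperator_graph (ε c : ℝ) (U : ℝ → ℝ) :
    (linearisedOperator ε c U).graph = linearisedGraph ε c U :=
  Submodule.toLinearPMap_graph_eq _ (linearisedGraph_functional ε c U)

/-! ### Spectrum and sectoriality of an unbounded operator -/

section Spectrum

variable {X : Type*} [NormedAddCommGroup X] [NormedSpace ℂ X]

/-- The bounded operator `S` is the two-sided inverse of `z - T : dom T → X`. -/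
def IsResolventAt (T : X →ₗ.[ℂ] X) (z : ℂ) (S : X →L[ℂ] X) : Prop :=
  (∀ f : X, ∃ h : S f ∈ T.domain, z • S f - T ⟨S f, h⟩ = f) ∧
    ∀ u : T.domain, S (z • (u : X) - T u) = u

/-- The spectrum of an unbounded operator `T`: the set of those `z` for which `z - T` has no
bounded inverse defined on the whole space. -/
def opSpectrum (T : X →ₗ.[ℂ] X) : Set ℂ := {z | ¬ ∃ S : X →L[ℂ] X, IsResolventAt T z S}

/-- `T` is sectorial (as a generator; this is the usual definition of sectoriality of `-T`): it is
closed and densely defined, and there are a vertex `a ∈ ℝ`, an angle `φ ∈ (0, π/2)` and a constant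
`C` such that every `z ≠ a` with `|arg (z - a)| ≤ π - φ` lies in the resolvent set, with
`‖(z - T)⁻¹‖ ≤ C / |z - a|`. -/
def IsSectorial (T : X →ₗ.[ℂ] X) : Prop :=
  T.IsClosed ∧ Dense (T.domain : Set X) ∧
    ∃ a φ C : ℝ, 0 < φ ∧ φ < Real.pi / 2 ∧ 0 < C ∧
      ∀ z : ℂ, z ≠ a → |(z - a).arg| ≤ Real.pi - φ →
        ∃ S : X →L[ℂ] X, IsResolventAt T z S ∧ ‖S‖ ≤ C / ‖z - a‖

end Spectrum

end

end ShockWave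

/-! The operator is a lower order perturbation of `-ε² d⁴/dζ⁴`. For `|arg z| ≤ 3π/4` the number `z`
cannot cancel a nonnegative real (`norm_add_ge_of_sector`), so `z + ε² d⁴/dζ⁴` is inverted by a
Fourier multiplier `G` with `‖G‖ ≤ 4/‖z‖`. Two derivatives composed with `G` still cost only
`O(‖z‖^(-1/2))`, so `G` times the lower order part extends to a bounded `B` on `L²` with `‖B‖ ≤
N/√‖z‖` (`exists_resolvent_lowerPart`). Applying `G` to `(z - L)u = f` gives `(1 - B)u = G f`; for
large `z` a Neumann series yields the resolvent `(1 - B)⁻¹ G`, of norm at most `8/‖z‖`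
(`IsHeteroclinicWave.exists_resolvent`). Moving the vertex to the right gives sectoriality.

The wave enters only through its coefficients: the system is polynomial, so `U, W, P, V` generate an
algebra closed under differentiation, and the limits at both ends make its members bounded. -/

namespace ShockWave

/-! ### Functions of temperate growth from differential algebras -/

/-- A family of polynomially bounded functions that is closed under differentiation consists of
functions of temperate growth. -/
theorem hasTemperateGrowth_of_closed_deriv {A : Set (ℝ → ℂ)}
    (hderiv : ∀ f ∈ A, ∃ g ∈ A, ∀ x, HasDerivAt f (g x) x)
    (hbound : ∀ f ∈ A, ∃ (k : ℕ) (C : ℝ), ∀ x, ‖f x‖ ≤ C * (1 + ‖x‖) ^ k)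
    {f : ℝ → ℂ} (hf : f ∈ A) : f.HasTemperateGrowth := by
  have hmem : ∀ n : ℕ, iteratedDeriv n f ∈ A := by
    intro n
    induction n with
    | zero => simpa using hf
    | succ n ih =>
      obtain ⟨g, hg, hfg⟩ := hderiv _ ih
      rw [iteratedDeriv_succ, funext fun x ↦ (hfg x).deriv]
      exact hg
  refine ⟨contDiff_of_differentiable_iteratedDeriv fun n _ x ↦ ?_, fun n ↦ ?_⟩
  · obtain ⟨g, -, hg⟩ := hderiv _ (hmem n)
    exact (hg x).differentiableAt
  · obtain ⟨k, C, h⟩ := hbound _ (hmem n)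
    exact ⟨k, C, fun x ↦ by rw [norm_iteratedFDeriv_eq_norm_iteratedDeriv]; exact h x⟩

/-- The algebra generated by functions whose derivatives lie in it is closed under
differentiation. -/
theorem adjoin_closed_deriv {s : Set (ℝ → ℂ)}
    (hs : ∀ f ∈ s, ∃ g ∈ Algebra.adjoin ℂ s, ∀ x, HasDerivAt f (g x) x)
    {f : ℝ → ℂ} (hf : f ∈ Algebra.adjoin ℂ s) :
    ∃ g ∈ Algebra.adjoin ℂ s, ∀ x, HasDerivAt f (g x) x := by
  induction hf using Algebra.adjoin_induction with
  | mem f hf => exact hs f hf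
  | algebraMap r => exact ⟨0, zero_mem _, fun x ↦ hasDerivAt_const x r⟩
  | add f g hf hg ihf ihg =>
    obtain ⟨f', hf', hff⟩ := ihf
    obtain ⟨g', hg', hgg⟩ := ihg
    exact ⟨f' + g', add_mem hf' hg', fun x ↦ (hff x).add (hgg x)⟩
  | mul f g hf hg ihf ihg =>
    obtain ⟨f', hf', hff⟩ := ihf
    obtain ⟨g', hg', hgg⟩ := ihg
    exact ⟨f' * g + f * g', add_mem (mul_mem hf' hg) (mul_mem hf hg'),
      fun x ↦ (hff x).mul (hgg x)⟩

theorem adjoin_polynomially_bounded {s : Set (ℝ → ℂ)}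
    (hs : ∀ f ∈ s, ∃ (k : ℕ) (C : ℝ), ∀ x, ‖f x‖ ≤ C * (1 + ‖x‖) ^ k)
    {f : ℝ → ℂ} (hf : f ∈ Algebra.adjoin ℂ s) :
    ∃ (k : ℕ) (C : ℝ), ∀ x, ‖f x‖ ≤ C * (1 + ‖x‖) ^ k := by
  induction hf using Algebra.adjoin_induction with
  | mem f hf => exact hs f hf
  | algebraMap r => exact ⟨0, ‖r‖, fun x ↦ by simp⟩
  | add f g hf hg ihf ihg =>
    obtain ⟨k, C, h⟩ := ihf
    obtain ⟨l, C', h'⟩ := ihg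
    refine ⟨k + l, |C| + |C'|, fun x ↦ ?_⟩
    calc ‖(f + g) x‖ ≤ ‖f x‖ + ‖g x‖ := norm_add_le _ _
      _ ≤ C * (1 + ‖x‖) ^ k + C' * (1 + ‖x‖) ^ l := add_le_add (h x) (h' x)
      _ ≤ |C| * (1 + ‖x‖) ^ (k + l) + |C'| * (1 + ‖x‖) ^ (k + l) := by
        gcongr <;> first | exact le_abs_self _ | omega | simp
      _ = _ := by ring
  | mul f g hf hg ihf ihg =>
    obtain ⟨k, C, h⟩ := ihf
    obtain ⟨l, C', h'⟩ := ihg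
    refine ⟨k + l, C * C', fun x ↦ ?_⟩
    calc ‖(f * g) x‖ = ‖f x‖ * ‖g x‖ := norm_mul _ _
      _ ≤ (C * (1 + ‖x‖) ^ k) * (C' * (1 + ‖x‖) ^ l) :=
        mul_le_mul (h x) (h' x) (norm_nonneg _) ((norm_nonneg _).trans (h x))
      _ = _ := by ring

theorem adjoin_bounded {s : Set (ℝ → ℂ)} (hs : ∀ f ∈ s, ∃ C : ℝ, ∀ x, ‖f x‖ ≤ C)
    {f : ℝ → ℂ} (hf : f ∈ Algebra.adjoin ℂ s) : ∃ C : ℝ, ∀ x, ‖f x‖ ≤ C := by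
  induction hf using Algebra.adjoin_induction with
  | mem f hf => exact hs f hf
  | algebraMap r => exact ⟨‖r‖, fun x ↦ le_rfl⟩
  | add f g hf hg ihf ihg =>
    obtain ⟨C, h⟩ := ihf
    obtain ⟨C', h'⟩ := ihg
    exact ⟨C + C', fun x ↦ (norm_add_le _ _).trans (add_le_add (h x) (h' x))⟩
  | mul f g hf hg ihf ihg =>
    obtain ⟨C, h⟩ := ihf
    obtain ⟨C', h'⟩ := ihg
    exact ⟨C * C', fun x ↦ (norm_mul _ _).le.trans
      (mul_le_mul (h x) (h' x) (norm_nonneg _) ((norm_nonneg _).trans (h x)))⟩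

/-- A continuous function on the line with limits at both ends is bounded. -/
theorem bounded_of_tendsto {f : ℝ → ℝ} {a b : ℝ} (hf : Continuous f)
    (ha : Tendsto f atBot (𝓝 a)) (hb : Tendsto f atTop (𝓝 b)) : ∃ C : ℝ, ∀ x, ‖f x‖ ≤ C := by
  obtain ⟨A, hA⟩ := eventually_atBot.1 (ha.norm.eventually_le_const (lt_add_one ‖a‖))
  obtain ⟨B, hB⟩ := eventually_atTop.1 (hb.norm.eventually_le_const (lt_add_one ‖b‖))
  obtain ⟨C, hC⟩ := isCompact_Icc.exists_bound_of_continuousOn (s := Set.Icc A B) hf.continuousOn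
  refine ⟨max C (max (‖a‖ + 1) (‖b‖ + 1)), fun x ↦ ?_⟩
  rcases le_total x A with h | h
  · exact (hA x h).trans ((le_max_left _ _).trans (le_max_right _ _))
  rcases le_total B x with h' | h'
  · exact (hB x h').trans ((le_max_right _ _).trans (le_max_right _ _))
  · exact (hC x ⟨h, h'⟩).trans (le_max_left _ _)

/-- Bounded functions of temperate growth. -/
def IsSmoothBounded (f : ℝ → ℂ) : Prop := f.HasTemperateGrowth ∧ ∃ C : ℝ, ∀ x, ‖f x‖ ≤ C

theorem deriv_reaction (u : ℝ) : deriv reaction u = -15 * u ^ 2 + 12 * u - 1 := by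
  have h : reaction = fun u ↦ -5 * u ^ 3 + 6 * u ^ 2 - u := by
    funext u; simp only [reaction]; ring
  rw [h]
  have := ((((hasDerivAt_pow 3 u).const_mul (-5)).add ((hasDerivAt_pow 2 u).const_mul 6)).sub
    (hasDerivAt_id u)).deriv
  refine Eq.trans ?_ (this.trans ?_)
  · rfl
  · norm_num; ring

/-- Along a heteroclinic wave, the diffusivity with its first two derivatives and the reaction rate
are bounded functions of temperate growth. -/
theorem IsHeteroclinicWave.coefficients {ε c : ℝ} {U W P V : ℝ → ℝ}
    (h : IsHeteroclinicWave ε c U W P V) :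
    (∃ d₁ d₂ : ℝ → ℂ, IsSmoothBounded (fun ζ ↦ (diffusion (U ζ) : ℂ)) ∧ IsSmoothBounded d₁ ∧
      IsSmoothBounded d₂ ∧ (∀ ζ, HasDerivAt (fun ζ ↦ (diffusion (U ζ) : ℂ)) (d₁ ζ) ζ) ∧
      ∀ ζ, HasDerivAt d₁ (d₂ ζ) ζ) ∧
    IsSmoothBounded fun ζ ↦ ((deriv reaction (U ζ) : ℝ) : ℂ) := by
  set u : ℝ → ℂ := fun ζ ↦ (U ζ : ℂ)
  set w : ℝ → ℂ := fun ζ ↦ (W ζ : ℂ)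
  set p : ℝ → ℂ := fun ζ ↦ (P ζ : ℂ)
  set v : ℝ → ℂ := fun ζ ↦ (V ζ : ℂ)
  set s : Set (ℝ → ℂ) := {u, w, p, v} with hs
  set A := Algebra.adjoin ℂ s
  have hu : u ∈ A := Algebra.subset_adjoin (by simp [hs])
  have hw : w ∈ A := Algebra.subset_adjoin (by simp [hs])
  have hp : p ∈ A := Algebra.subset_adjoin (by simp [hs])
  have hv : v ∈ A := Algebra.subset_adjoin (by simp [hs])
  have hc (a : ℂ) : (fun _ ↦ a : ℝ → ℂ) ∈ A := A.algebraMap_mem a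
  -- The right-hand sides of the wave system are polynomials in the four unknowns.
  have hder : ∀ f ∈ s, ∃ g ∈ A, ∀ x, HasDerivAt f (g x) x := by
    rintro f (rfl | rfl | rfl | rfl)
    · refine ⟨_, mul_mem hw (hc (ε⁻¹ : ℂ)), fun x ↦ ?_⟩
      refine (h.ode_U x).ofReal_comp.congr_deriv ?_
      simp [w, div_eq_mul_inv]
    · refine ⟨_, mul_mem (sub_mem (add_mem (sub_mem (mul_mem (hc 2) (pow_mem hu 3))
        (mul_mem (hc 4) (pow_mem hu 2))) (mul_mem (hc (21 / 8)) hu)) hv) (hc (ε⁻¹ : ℂ)),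
        fun x ↦ ?_⟩
      refine (h.ode_W x).ofReal_comp.congr_deriv ?_
      simp [u, v, potential, div_eq_mul_inv]
    · refine ⟨_, mul_mem (mul_mem (mul_mem (hc (-5)) hu) (sub_mem (hc 1) hu))
        (sub_mem hu (hc (1 / 5))), fun x ↦ ?_⟩
      refine (h.ode_P x).ofReal_comp.congr_deriv ?_
      simp [u, reaction]
    · refine ⟨_, sub_mem hp (mul_mem (hc c) hu), fun x ↦ ?_⟩
      refine (h.ode_V x).ofReal_comp.congr_deriv ?_
      simp [u, p]
  have hbot := h.tendsto_atBot
  have htop := h.tendsto_atTop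
  simp only [Prod.tendsto_iff] at hbot htop
  have hbd : ∀ f ∈ s, ∃ C : ℝ, ∀ x, ‖f x‖ ≤ C := by
    rintro f (rfl | rfl | rfl | rfl)
    · simpa [u] using bounded_of_tendsto (continuous_iff_continuousAt.2 fun x ↦
        (h.ode_U x).continuousAt) hbot.1 htop.1
    · simpa [w] using bounded_of_tendsto (continuous_iff_continuousAt.2 fun x ↦
        (h.ode_W x).continuousAt) hbot.2.1 htop.2.1
    · simpa [p] using bounded_of_tendsto (continuous_iff_continuousAt.2 fun x ↦
        (h.ode_P x).continuousAt) hbot.2.2.1 htop.2.2.1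
    · simpa [v] using bounded_of_tendsto (continuous_iff_continuousAt.2 fun x ↦
        (h.ode_V x).continuousAt) hbot.2.2.2 htop.2.2.2
  have hA : ∀ f ∈ A, IsSmoothBounded f := fun f hf ↦
    ⟨hasTemperateGrowth_of_closed_deriv (A := (A : Set (ℝ → ℂ)))
      (fun f hf ↦ adjoin_closed_deriv hder hf)
      (fun f hf ↦ (adjoin_bounded hbd hf).imp' (fun _ ↦ 0) (fun C h ↦ ⟨C, by simpa using h⟩)) hf,
      adjoin_bounded hbd hf⟩
  have hd : (fun ζ ↦ (diffusion (U ζ) : ℂ)) ∈ A := by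
    have : (fun ζ ↦ (diffusion (U ζ) : ℂ)) =
        (fun _ ↦ 6) * (u - fun _ ↦ 7 / 12) * (u - fun _ ↦ 3 / 4) := by
      funext ζ; simp [u, diffusion]
    rw [this]
    exact mul_mem (mul_mem (hc _) (sub_mem hu (hc _))) (sub_mem hu (hc _))
  have hr : (fun ζ ↦ ((deriv reaction (U ζ) : ℝ) : ℂ)) ∈ A := by
    have : (fun ζ ↦ ((deriv reaction (U ζ) : ℝ) : ℂ)) =
        (fun _ ↦ -15) * u ^ 2 + (fun _ ↦ 12) * u - fun _ ↦ 1 := by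
      funext ζ; simp [u, deriv_reaction]
    rw [this]
    exact sub_mem (add_mem (mul_mem (hc _) (pow_mem hu 2)) (mul_mem (hc _) hu)) (hc _)
  obtain ⟨d₁, h₁, hd₁⟩ := adjoin_closed_deriv hder hd
  obtain ⟨d₂, h₂, hd₂⟩ := adjoin_closed_deriv hder h₁
  exact ⟨⟨d₁, d₂, hA _ hd, hA _ h₁, hA _ h₂, hd₁, hd₂⟩, hA _ hr⟩

/-- The reciprocal of a quartic `z + b ξ⁴` that is bounded away from zero has temperate growth. -/
theorem hasTemperateGrowth_inv_quartic {z b : ℂ} {δ : ℝ} (hδ : 0 < δ)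
    (h : ∀ ξ : ℝ, δ ≤ ‖z + b * (ξ : ℂ) ^ 4‖) :
    (fun ξ : ℝ ↦ (z + b * (ξ : ℂ) ^ 4)⁻¹).HasTemperateGrowth := by
  set r : ℝ → ℂ := fun ξ : ℝ ↦ (z + b * (ξ : ℂ) ^ 4)⁻¹
  set t : ℝ → ℂ := fun ξ ↦ (ξ : ℂ)
  set A := Algebra.adjoin ℂ {r, t}
  have hr : r ∈ A := Algebra.subset_adjoin (by simp)
  have ht : t ∈ A := Algebra.subset_adjoin (by simp)
  have hc (a : ℂ) : (fun _ ↦ a : ℝ → ℂ) ∈ A := A.algebraMap_mem a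
  refine hasTemperateGrowth_of_closed_deriv (A := (A : Set (ℝ → ℂ)))
      (fun f hf ↦ adjoin_closed_deriv ?_ hf) (fun f hf ↦ adjoin_polynomially_bounded ?_ hf) hr
  · rintro f (rfl | rfl)
    -- The derivative is `-4 b ξ³ r²`, which is why `ξ` is needed as a second generator.
    · refine ⟨_, mul_mem (mul_mem (hc (-4 * b)) (pow_mem ht 3)) (pow_mem hr 2), fun x ↦ ?_⟩
      have h0 : z + b * (x : ℂ) ^ 4 ≠ 0 := norm_pos_iff.1 (hδ.trans_le (h x))
      have h1 : HasDerivAt (fun ξ : ℝ ↦ z + b * (ξ : ℂ) ^ 4) (b * (4 * (x : ℂ) ^ 3)) x := by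
        have := (((hasDerivAt_id (x : ℂ)).pow 4).const_mul b).const_add z
        simpa using this.comp_ofReal
      refine (h1.fun_inv h0).congr_deriv ?_
      simp only [Pi.mul_apply, Pi.pow_apply, r, t]
      field_simp
    · refine ⟨_, hc 1, fun x ↦ ?_⟩
      exact (hasDerivAt_id (x : ℂ)).comp_ofReal
  · rintro f (rfl | rfl)
    · refine ⟨0, δ⁻¹, fun x ↦ ?_⟩
      simp only [r, norm_inv, pow_zero, mul_one]
      exact inv_anti₀ hδ (h x)
    · exact ⟨1, 1, fun x ↦ by simp [t]⟩

open TemperedDistribution FourierTransform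

/-! ### Multiplication operators and Fourier multipliers on `L²` -/

theorem toDist_injective : Function.Injective toDist :=
  LinearMap.ker_eq_bot.1
    (Lp.ker_toTemperedDistributionCLM_eq_bot (F := ℂ) (μ := (volume : Measure ℝ)) (p := 2))

/-- Multiplication by a bounded function of temperate growth is bounded on `L²`, and compatible with
multiplication of distributions. -/
theorem exists_mul_operator {g : ℝ → ℂ} (hg : g.HasTemperateGrowth) {C : ℝ} (hC : 0 ≤ C)
    (hb : ∀ x, ‖g x‖ ≤ C) :
    ∃ S : L2 →L[ℂ] L2, ‖S‖ ≤ C ∧ (∀ u, toDist (S u) = smulLeftCLM ℂ g (toDist u)) ∧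
      ∀ u : L2, ∀ᵐ x : ℝ, S u x = g x * u x := by
  have hm : MemLp g ⊤ (volume : Measure ℝ) :=
    memLp_top_of_bound hg.1.continuous.aestronglyMeasurable C (Eventually.of_forall hb)
  have hn : ‖hm.toLp g‖ ≤ C := by
    rw [Lp.norm_toLp, eLpNorm_exponent_top]
    exact ENNReal.toReal_le_of_le_ofReal hC
      (eLpNormEssSup_le_of_ae_bound (Eventually.of_forall hb))
  let S₀ : L2 →ₗ[ℂ] L2 :=
    { toFun := fun u ↦ hm.toLp g • u
      map_add' := fun u v ↦ Lp.add_smul _ _ _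
      map_smul' := fun a u ↦ (Lp.smul_comm a (hm.toLp g) u).symm }
  refine ⟨S₀.mkContinuous C fun u ↦ ?_, LinearMap.mkContinuous_norm_le _ hC _, fun u ↦ ?_,
    fun u ↦ ?_⟩
  · exact (Lp.norm_smul_le _ _).trans (mul_le_mul_of_nonneg_right hn (norm_nonneg u))
  · exact Lp.toTemperedDistribution_smul_eq hg hm u
  · filter_upwards [Lp.coeFn_lpSMul (r := 2) (hm.toLp g) u, hm.coeFn_toLp] with x h1 h2
    refine h1.trans ?_
    simp [h2]

/-- The Fourier multiplier with a bounded symbol of temperate growth is bounded on `L²`. -/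
theorem exists_fourierMultiplier_operator {g : ℝ → ℂ} (hg : g.HasTemperateGrowth) {C : ℝ}
    (hC : 0 ≤ C) (hb : ∀ x, ‖g x‖ ≤ C) :
    ∃ S : L2 →L[ℂ] L2, ‖S‖ ≤ C ∧ ∀ u, toDist (S u) = fourierMultiplierCLM ℂ g (toDist u) := by
  obtain ⟨S, hS, hSu, -⟩ := exists_mul_operator hg hC hb
  let Φ := Lp.fourierTransformₗᵢ ℝ ℂ
  -- Conjugation by the isometric Fourier transform (Plancherel) preserves the norm bound.
  refine ⟨(Φ.symm.toLinearIsometry.toContinuousLinearMap ∘L S) ∘L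
    Φ.toLinearIsometry.toContinuousLinearMap, ?_, fun u ↦ ?_⟩
  · refine ContinuousLinearMap.opNorm_le_bound _ hC fun u ↦ ?_
    calc ‖Φ.symm (S (Φ u))‖ = ‖S (Φ u)‖ := Φ.symm.norm_map _
      _ ≤ C * ‖Φ u‖ := S.le_of_opNorm_le hS _
      _ = C * ‖u‖ := by rw [Φ.norm_map]
  · change Lp.toTemperedDistribution (𝓕⁻ (S (𝓕 u))) = _
    rw [← Lp.fourierInv_toTemperedDistribution_eq, fourierMultiplierCLM_apply]
    congr 1
    refine (hSu _).trans ?_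
    congr 1
    exact (Lp.fourier_toTemperedDistribution_eq u).symm

/-! ### Derivatives of distributions -/

/-- The symbol of `d/dζ`. -/
noncomputable def dsymbol (ξ : ℝ) : ℂ := 2 * Real.pi * Complex.I * ξ

theorem hasTemperateGrowth_dsymbol : dsymbol.HasTemperateGrowth := by
  unfold dsymbol
  fun_prop

theorem ddx_eq_lineDeriv (f : 𝓢'(ℝ, ℂ)) : ddx f = LineDeriv.lineDerivOp (1 : ℝ) f := by
  ext φ
  rw [derivCLM_apply_apply, lineDerivOp_apply_apply]
  congr 2

theorem ddx_eq_fourierMultiplier (f : 𝓢'(ℝ, ℂ)) : ddx f = fourierMultiplierCLM ℂ dsymbol f := by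
  rw [ddx_eq_lineDeriv, lineDeriv_eq_fourierMultiplierCLM]
  have h : dsymbol = (2 * Real.pi * Complex.I) • fun ξ : ℝ ↦ ((inner ℝ ξ (1 : ℝ) : ℝ) : ℂ) := by
    funext ξ
    simp [dsymbol]
  rw [h, fourierMultiplierCLM_smul (by fun_prop)]
  rfl

/-- The product rule for distributions. -/
theorem ddx_smulLeft {g g' : ℝ → ℂ} (hg : g.HasTemperateGrowth) (hg' : g'.HasTemperateGrowth)
    (h : ∀ x, HasDerivAt g (g' x) x) (f : 𝓢'(ℝ, ℂ)) :
    ddx (smulLeftCLM ℂ g f) = smulLeftCLM ℂ g' f + smulLeftCLM ℂ g (ddx f) := by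
  ext φ
  -- Both sides are `f` at Schwartz functions; what remains is `-g φ' = g' φ - (g φ)'`.
  change f _ = f _ + f _
  rw [← map_add]
  congr 1
  ext x
  have h1 := (h x).mul (φ.differentiableAt (x := x)).hasDerivAt
  have h2 : deriv (SchwartzMap.smulLeftCLM ℂ g φ) x = g' x * φ x + g x * deriv φ x := by
    rw [← h1.deriv]
    congr 1
    funext y
    simp [SchwartzMap.smulLeftCLM_apply_apply hg]
  simp [SchwartzMap.smulLeftCLM_apply_apply hg, SchwartzMap.smulLeftCLM_apply_apply hg',
    SchwartzMap.derivCLM_apply, h2]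

theorem memSobolev_ddx {s : ℝ} {f : 𝓢'(ℝ, ℂ)} (hf : MemSobolev s 2 f) :
    MemSobolev (s - 1) 2 (ddx f) := by
  rw [ddx_eq_lineDeriv]
  exact hf.lineDerivOp

theorem memSobolev_zero_toDist (u : L2) : MemSobolev 0 2 (toDist u) :=
  memSobolev_zero_iff.2 ⟨u, rfl⟩

theorem memSobolev_zero_smulLeft {g : ℝ → ℂ} (hg : IsSmoothBounded g) {f : 𝓢'(ℝ, ℂ)}
    (hf : MemSobolev 0 2 f) : MemSobolev 0 2 (smulLeftCLM ℂ g f) := by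
  obtain ⟨u, rfl⟩ := memSobolev_zero_iff.1 hf
  obtain ⟨hg, C, hC⟩ := hg
  obtain ⟨S, -, hS, -⟩ := exists_mul_operator hg ((norm_nonneg _).trans (hC 0)) hC
  exact memSobolev_zero_iff.2 ⟨S u, (hS u).symm⟩

/-- If `u ∈ H²` then `(g u)'' ∈ L²`, for `g` smooth with bounded derivatives. -/
theorem memSobolev_ddx_ddx_smulLeft {g g₁ g₂ : ℝ → ℂ} (hg : IsSmoothBounded g)
    (hg₁ : IsSmoothBounded g₁) (hg₂ : IsSmoothBounded g₂) (h : ∀ x, HasDerivAt g (g₁ x) x)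
    (h₁ : ∀ x, HasDerivAt g₁ (g₂ x) x) {f : 𝓢'(ℝ, ℂ)} (hf : MemSobolev 2 2 f) :
    MemSobolev 0 2 (ddx (ddx (smulLeftCLM ℂ g f))) := by
  have hf0 : MemSobolev 0 2 f := hf.mono (by norm_num)
  have hf1 := memSobolev_ddx hf
  have hf2 := memSobolev_ddx hf1
  norm_num at hf1 hf2
  have hf10 : MemSobolev 0 2 (ddx f) := hf1.mono (by norm_num)
  rw [ddx_smulLeft hg.1 hg₁.1 h, map_add, ddx_smulLeft hg₁.1 hg₂.1 h₁, ddx_smulLeft hg.1 hg₁.1 h]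
  exact ((memSobolev_zero_smulLeft hg₂ hf0).add (memSobolev_zero_smulLeft hg₁ hf10)).add
    ((memSobolev_zero_smulLeft hg₁ hf10).add (memSobolev_zero_smulLeft hg hf2))

/-! ### The symbol of the resolvent of the leading part -/

/-- The hypothesis on `z` is `|arg z| ≤ 3π/4` in algebraic form, which keeps `z` at an angle of at
least `π/4` from the negative axis. The constant `1/4` is not sharp. -/
theorem norm_add_ge_of_sector {z : ℂ} (hz : -z.re ≤ |z.im|) {t : ℝ} (ht : 0 ≤ t) :
    (‖z‖ + t) / 4 ≤ ‖z + t‖ := by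
  have h1 : ‖z‖ ^ 2 = z.re ^ 2 + z.im ^ 2 := by
    rw [Complex.sq_norm, Complex.normSq_apply]; ring
  have h2 : ‖z + t‖ ^ 2 = (z.re + t) ^ 2 + z.im ^ 2 := by
    rw [Complex.sq_norm, Complex.normSq_apply]; simp; ring
  refine le_of_sq_le_sq ?_ (norm_nonneg _)
  rw [h2]
  have h3 : (‖z‖ + t) ^ 2 ≤ 2 * ‖z‖ ^ 2 + 2 * t ^ 2 := by nlinarith [sq_nonneg (‖z‖ - t)]
  suffices h : 2 * ‖z‖ ^ 2 + 2 * t ^ 2 ≤ 16 * ((z.re + t) ^ 2 + z.im ^ 2) by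
    rw [div_pow]; linarith
  rw [h1]
  rcases le_total 0 z.re with h | h
  · nlinarith [mul_nonneg h ht, sq_nonneg z.re, sq_nonneg z.im, sq_nonneg t]
  · have h4 : z.re ^ 2 ≤ z.im ^ 2 := by
      rw [← sq_abs z.im]
      nlinarith [abs_nonneg z.im]
    -- With `x = z.re` and `z.im² ≥ x²`, the difference is at least `28x² + 32xt + 14t² ≥ (4/3)(4x +
    -- 3t)²`.
    nlinarith [sq_nonneg (4 * z.re + 3 * t)]

/-- The symbol of `(z + ε² d⁴/dζ⁴)⁻¹`. -/
noncomputable def resolventSymbol (ε : ℝ) (z : ℂ) (ξ : ℝ) : ℂ :=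
  (z + ((ε ^ 2 * (2 * Real.pi) ^ 4 : ℝ) : ℂ) * (ξ : ℂ) ^ 4)⁻¹

theorem norm_dsymbol (ξ : ℝ) : ‖dsymbol ξ‖ = 2 * Real.pi * |ξ| := by
  simp [dsymbol, abs_of_pos Real.pi_pos]

section Symbol

variable {ε : ℝ} {z : ℂ}

theorem norm_quartic_ge (hz : -z.re ≤ |z.im|) (ξ : ℝ) :
    (‖z‖ + ε ^ 2 * ‖dsymbol ξ‖ ^ 4) / 4 ≤
      ‖z + ((ε ^ 2 * (2 * Real.pi) ^ 4 : ℝ) : ℂ) * (ξ : ℂ) ^ 4‖ := by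
  have h := norm_add_ge_of_sector hz (t := ε ^ 2 * (2 * Real.pi) ^ 4 * ξ ^ 4) (by positivity)
  have h1 : ‖dsymbol ξ‖ ^ 4 = (2 * Real.pi) ^ 4 * ξ ^ 4 := by
    rw [norm_dsymbol, mul_pow, Even.pow_abs (by decide)]
  rw [h1, ← mul_assoc]
  push_cast at h ⊢
  exact h

theorem quartic_ge_pos (hz : -z.re ≤ |z.im|) (ξ : ℝ) :
    ‖z‖ / 4 ≤ ‖z + ((ε ^ 2 * (2 * Real.pi) ^ 4 : ℝ) : ℂ) * (ξ : ℂ) ^ 4‖ := by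
  refine le_trans ?_ (norm_quartic_ge hz ξ)
  have : 0 ≤ ε ^ 2 * ‖dsymbol ξ‖ ^ 4 := by positivity
  linarith

theorem hasTemperateGrowth_resolventSymbol (hz : -z.re ≤ |z.im|) (hz0 : 0 < ‖z‖) :
    (resolventSymbol ε z).HasTemperateGrowth :=
  hasTemperateGrowth_inv_quartic (by positivity : 0 < ‖z‖ / 4) (quartic_ge_pos hz)

theorem resolventSymbol_mul (hz : -z.re ≤ |z.im|) (hz0 : 0 < ‖z‖) (ξ : ℝ) :
    (z + (ε : ℂ) ^ 2 * dsymbol ξ ^ 4) * resolventSymbol ε z ξ = 1 := by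
  have h : z + (ε : ℂ) ^ 2 * dsymbol ξ ^ 4 =
      z + ((ε ^ 2 * (2 * Real.pi) ^ 4 : ℝ) : ℂ) * (ξ : ℂ) ^ 4 := by
    simp only [dsymbol, mul_pow, Complex.I_pow_four]
    push_cast
    ring
  rw [h, resolventSymbol]
  exact mul_inv_cancel₀ (norm_pos_iff.1 ((by positivity : 0 < ‖z‖ / 4).trans_le
    (quartic_ge_pos hz ξ)))

theorem norm_resolventSymbol_le (hz : -z.re ≤ |z.im|) (hz0 : 0 < ‖z‖) (ξ : ℝ) :
    ‖resolventSymbol ε z ξ‖ ≤ 4 / ‖z‖ := by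
  rw [resolventSymbol, norm_inv, ← inv_div]
  exact inv_anti₀ (by positivity) (quartic_ge_pos hz ξ)

/-- By the arithmetic-geometric mean inequality, `‖z‖ + ε² s⁴ ≥ 2 ε √‖z‖ s²`. This decay makes the
second order term a small perturbation. -/
theorem norm_dsymbol_sq_mul_resolventSymbol_le (hε : 0 < ε) (hz : -z.re ≤ |z.im|) (hz0 : 0 < ‖z‖)
    (ξ : ℝ) : ‖dsymbol ξ‖ ^ 2 * ‖resolventSymbol ε z ξ‖ ≤ 2 / (ε * √‖z‖) := by
  have hs : 0 < √‖z‖ := Real.sqrt_pos.2 hz0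
  have h1 := norm_quartic_ge (ε := ε) hz ξ
  have h2 := (by positivity : 0 < ‖z‖ / 4).trans_le (quartic_ge_pos (ε := ε) hz ξ)
  rw [resolventSymbol, norm_inv, ← div_eq_mul_inv, div_le_div_iff₀ h2 (by positivity)]
  have h3 : 2 * (√‖z‖ * (ε * ‖dsymbol ξ‖ ^ 2)) ≤ ‖z‖ + ε ^ 2 * ‖dsymbol ξ‖ ^ 4 := by
    have h4 := sq_nonneg (√‖z‖ - ε * ‖dsymbol ξ‖ ^ 2)
    have h5 := Real.sq_sqrt hz0.le
    nlinarith
  nlinarith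

theorem norm_dsymbol_mul_resolventSymbol_le (hε : 0 < ε) (hz : -z.re ≤ |z.im|) (hz0 : 0 < ‖z‖)
    (ξ : ℝ) : ‖dsymbol ξ‖ * ‖resolventSymbol ε z ξ‖ ≤ 4 / ‖z‖ + 2 / (ε * √‖z‖) := by
  have h1 := norm_resolventSymbol_le (ε := ε) hz hz0 ξ
  have h2 := norm_dsymbol_sq_mul_resolventSymbol_le hε hz hz0 ξ
  have h3 : ‖dsymbol ξ‖ ≤ 1 + ‖dsymbol ξ‖ ^ 2 := by nlinarith [sq_nonneg (‖dsymbol ξ‖ - 1)]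
  have h4 := mul_le_mul_of_nonneg_right h3 (norm_nonneg (resolventSymbol ε z ξ))
  linarith

/-- The weight `(1 + ξ²)²` is the Bessel symbol of order four. The bound serves only Sobolev
regularity, so no decay in `z` is needed. -/
theorem norm_bessel_mul_resolventSymbol_le (hε : 0 < ε) (hz : -z.re ≤ |z.im|) (hz0 : 0 < ‖z‖)
    (ξ : ℝ) : (1 + ξ ^ 2) ^ 2 * ‖resolventSymbol ε z ξ‖ ≤ 8 / min ‖z‖ (ε ^ 2) := by
  have hm : 0 < min ‖z‖ (ε ^ 2) := lt_min hz0 (by positivity)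
  have h1 := norm_quartic_ge (ε := ε) hz ξ
  have h2 := (by positivity : 0 < ‖z‖ / 4).trans_le (quartic_ge_pos (ε := ε) hz ξ)
  rw [resolventSymbol, norm_inv, ← div_eq_mul_inv, div_le_div_iff₀ h2 hm]
  have h3 : ξ ^ 4 ≤ ‖dsymbol ξ‖ ^ 4 := by
    rw [norm_dsymbol, ← Even.pow_abs (by decide : Even 4) ξ]
    refine pow_le_pow_left₀ (abs_nonneg _) ?_ 4
    nlinarith [abs_nonneg ξ, Real.pi_gt_three]
  have h4 : min ‖z‖ (ε ^ 2) * (1 + ξ ^ 4) ≤ ‖z‖ + ε ^ 2 * ‖dsymbol ξ‖ ^ 4 := by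
    rw [mul_add, mul_one]
    exact add_le_add (min_le_left _ _)
      (mul_le_mul (min_le_right _ _) h3 (by positivity) (by positivity))
  have h5 : (1 + ξ ^ 2) ^ 2 ≤ 2 * (1 + ξ ^ 4) := by nlinarith [sq_nonneg (ξ ^ 2 - 1)]
  have h6 := mul_le_mul_of_nonneg_left h5 hm.le
  linarith

end Symbol

/-! ### The leading part and its inverse on distributions -/

theorem fourierMultiplier_add {g h : ℝ → ℂ} (hg : g.HasTemperateGrowth)
    (hh : h.HasTemperateGrowth) (f : 𝓢'(ℝ, ℂ)) :
    fourierMultiplierCLM ℂ (g + h) f = fourierMultiplierCLM ℂ g f + fourierMultiplierCLM ℂ h f := by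
  simp only [fourierMultiplierCLM_apply, smulLeftCLM_add hg hh, add_apply,
    FourierTransform.fourierInv_add]

theorem leadingPart_eq_fourierMultiplier (ε : ℝ) (z : ℂ) (f : 𝓢'(ℝ, ℂ)) :
    z • f + (ε ^ 2 : ℂ) • ddx (ddx (ddx (ddx f))) =
      fourierMultiplierCLM ℂ (fun ξ ↦ z + (ε : ℂ) ^ 2 * dsymbol ξ ^ 4) f := by
  have hd := hasTemperateGrowth_dsymbol
  have h : (fun ξ ↦ z + (ε : ℂ) ^ 2 * dsymbol ξ ^ 4) =
      (fun _ ↦ z) + ((ε : ℂ) ^ 2) • ((dsymbol * dsymbol) * (dsymbol * dsymbol)) := by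
    funext ξ
    simp only [Pi.add_apply, Pi.smul_apply, Pi.mul_apply, smul_eq_mul]
    ring
  have h4 : ((dsymbol * dsymbol) * (dsymbol * dsymbol)).HasTemperateGrowth :=
    (hd.mul hd).mul (hd.mul hd)
  have h4' : (((ε : ℂ) ^ 2) • ((dsymbol * dsymbol) * (dsymbol * dsymbol))).HasTemperateGrowth :=
    (Function.HasTemperateGrowth.const ((ε : ℂ) ^ 2)).mul h4
  rw [h, fourierMultiplier_add (by fun_prop) h4', fourierMultiplierCLM_smul h4]
  simp only [ddx_eq_fourierMultiplier]
  rw [fourierMultiplierCLM_fourierMultiplierCLM_apply hd hd,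
    fourierMultiplierCLM_fourierMultiplierCLM_apply hd hd,
    fourierMultiplierCLM_fourierMultiplierCLM_apply (hd.mul hd) (hd.mul hd),
    fourierMultiplierCLM_const]
  rfl

section Inverse

variable {ε : ℝ} {z : ℂ}

theorem hasTemperateGrowth_leadingSymbol :
    (fun ξ ↦ z + (ε : ℂ) ^ 2 * dsymbol ξ ^ 4).HasTemperateGrowth := by
  have hd := hasTemperateGrowth_dsymbol
  fun_prop

theorem resolvent_leadingPart (hz : -z.re ≤ |z.im|) (hz0 : 0 < ‖z‖) (f : 𝓢'(ℝ, ℂ)) :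
    fourierMultiplierCLM ℂ (resolventSymbol ε z)
      (z • f + (ε ^ 2 : ℂ) • ddx (ddx (ddx (ddx f)))) = f := by
  rw [leadingPart_eq_fourierMultiplier, fourierMultiplierCLM_fourierMultiplierCLM_apply
    hasTemperateGrowth_leadingSymbol (hasTemperateGrowth_resolventSymbol hz hz0)]
  have h : (fun ξ ↦ z + (ε : ℂ) ^ 2 * dsymbol ξ ^ 4) * resolventSymbol ε z = fun _ ↦ 1 :=
    funext (resolventSymbol_mul hz hz0)
  rw [h, fourierMultiplierCLM_const, one_smul]
  rfl

theorem leadingPart_resolvent (hz : -z.re ≤ |z.im|) (hz0 : 0 < ‖z‖) (f : 𝓢'(ℝ, ℂ)) :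
    z • fourierMultiplierCLM ℂ (resolventSymbol ε z) f +
      (ε ^ 2 : ℂ) • ddx (ddx (ddx (ddx (fourierMultiplierCLM ℂ (resolventSymbol ε z) f)))) = f := by
  rw [leadingPart_eq_fourierMultiplier, fourierMultiplierCLM_fourierMultiplierCLM_apply
    (hasTemperateGrowth_resolventSymbol hz hz0) hasTemperateGrowth_leadingSymbol, mul_comm]
  have h : (fun ξ ↦ z + (ε : ℂ) ^ 2 * dsymbol ξ ^ 4) * resolventSymbol ε z = fun _ ↦ 1 :=
    funext (resolventSymbol_mul hz hz0)
  rw [h, fourierMultiplierCLM_const, one_smul]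
  rfl

/-- The inverse of the leading part gains four derivatives. -/
theorem memSobolev_resolvent (hε : 0 < ε) (hz : -z.re ≤ |z.im|) (hz0 : 0 < ‖z‖) {s : ℝ}
    {f : 𝓢'(ℝ, ℂ)} (hf : MemSobolev s 2 f) :
    MemSobolev (4 + s) 2 (fourierMultiplierCLM ℂ (resolventSymbol ε z) f) := by
  have hr := hasTemperateGrowth_resolventSymbol (ε := ε) hz hz0
  rw [← memSobolev_besselPotential_iff, besselPotential,
    fourierMultiplierCLM_fourierMultiplierCLM_apply hr (by fun_prop)]
  refine hf.fourierMultiplierCLM_of_bounded (hr.mul (by fun_prop)) ⟨8 / min ‖z‖ (ε ^ 2), fun ξ ↦ ?_⟩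
  refine le_trans (le_of_eq ?_) (norm_bessel_mul_resolventSymbol_le hε hz hz0 ξ)
  have h4 : (4 / 2 : ℝ) = ((2 : ℕ) : ℝ) := by norm_num
  rw [Pi.mul_apply, norm_mul, Complex.norm_real, mul_comm, h4, Real.rpow_natCast,
    Real.norm_of_nonneg (by positivity), Real.norm_eq_abs, sq_abs]

end Inverse

/-! ### The linearised operator as a relatively bounded perturbation -/

/-- The part `c f' + (d f)'' + r f` of lower order. -/
noncomputable def lowerPart (c : ℝ) (d r : ℝ → ℂ) (f : 𝓢'(ℝ, ℂ)) : 𝓢'(ℝ, ℂ) :=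
  (c : ℂ) • ddx f + ddx (ddx (smulLeftCLM ℂ d f)) + smulLeftCLM ℂ r f

/-- The auxiliary `q` and `r` are determined by `u` as products with smooth bounded coefficients, so
membership becomes a single equation between distributions. -/
theorem mem_linearisedGraph_iff {ε c : ℝ} {U : ℝ → ℝ}
    (hd : IsSmoothBounded fun ζ ↦ (diffusion (U ζ) : ℂ))
    (hr : IsSmoothBounded fun ζ ↦ ((deriv reaction (U ζ) : ℝ) : ℂ)) (u f : L2) :
    (u, f) ∈ linearisedGraph ε c U ↔ MemSobolev 4 2 (toDist u) ∧
      toDist f = lowerPart c (fun ζ ↦ (diffusion (U ζ) : ℂ))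
        (fun ζ ↦ ((deriv reaction (U ζ) : ℝ) : ℂ)) (toDist u)
        - (ε ^ 2 : ℂ) • ddx (ddx (ddx (ddx (toDist u)))) := by
  obtain ⟨hd, C, hC⟩ := hd
  obtain ⟨hr, C', hC'⟩ := hr
  obtain ⟨S, -, hS, hSu⟩ := exists_mul_operator hd ((norm_nonneg _).trans (hC 0)) hC
  obtain ⟨S', -, hS', hSu'⟩ := exists_mul_operator hr ((norm_nonneg _).trans (hC' 0)) hC'
  constructor
  · rintro ⟨h4, q, r, hq, hr, hf⟩
    have hq' : q = S u := by
      apply Lp.ext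
      filter_upwards [hq, hSu u] with x h1 h2
      rw [h1, h2]
    have hr' : r = S' u := by
      apply Lp.ext
      filter_upwards [hr, hSu' u] with x h1 h2
      rw [h1, h2]
    subst hq' hr'
    refine ⟨h4, hf.trans ?_⟩
    rw [hS, hS']
    rfl
  · rintro ⟨h4, hf⟩
    refine ⟨h4, S u, S' u, hSu u, hSu' u, hf.trans ?_⟩
    rw [hS, hS']
    rfl

section Sobolev

variable {c : ℝ} {d d₁ d₂ r : ℝ → ℂ}

/-- If `f ∈ H²`, then the lower order part is in `L²`. -/
theorem memSobolev_zero_lowerPart (hd : IsSmoothBounded d)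
    (hd₁ : IsSmoothBounded d₁) (hd₂ : IsSmoothBounded d₂) (h : ∀ x, HasDerivAt d (d₁ x) x)
    (h₁ : ∀ x, HasDerivAt d₁ (d₂ x) x) (hr : IsSmoothBounded r) {f : 𝓢'(ℝ, ℂ)}
    (hf : MemSobolev 2 2 f) : MemSobolev 0 2 (lowerPart c d r f) :=
  ((((memSobolev_ddx hf).mono (by norm_num)).smul _).add
    (memSobolev_ddx_ddx_smulLeft hd hd₁ hd₂ h h₁ hf)).add
    (memSobolev_zero_smulLeft hr (hf.mono (by norm_num)))

/-- If `f ∈ L²`, then the lower order part is in `H⁻²`. -/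
theorem memSobolev_neg_two_lowerPart (hd : IsSmoothBounded d) (hr : IsSmoothBounded r)
    {f : 𝓢'(ℝ, ℂ)} (hf : MemSobolev 0 2 f) : MemSobolev (-2) 2 (lowerPart c d r f) :=
  ((((memSobolev_ddx hf).mono (by norm_num)).smul _).add
    ((memSobolev_ddx (memSobolev_ddx (memSobolev_zero_smulLeft hd hf))).mono (by norm_num))).add
    ((memSobolev_zero_smulLeft hr hf).mono (by norm_num))

/-- The resolvent of the leading part composed with the lower order part is a small operator on
`L²`. -/
theorem exists_resolvent_lowerPart {ε : ℝ} (hε : 0 < ε) (hd : IsSmoothBounded d)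
    (hr : IsSmoothBounded r) :
    ∃ N : ℝ, 0 ≤ N ∧ ∀ z : ℂ, -z.re ≤ |z.im| → 1 ≤ ‖z‖ → ∃ G B : L2 →L[ℂ] L2,
      ‖G‖ ≤ 4 / ‖z‖ ∧ ‖B‖ ≤ N / √‖z‖ ∧
      (∀ u, toDist (G u) = fourierMultiplierCLM ℂ (resolventSymbol ε z) (toDist u)) ∧
      ∀ u, toDist (B u) =
        fourierMultiplierCLM ℂ (resolventSymbol ε z) (lowerPart c d r (toDist u)) := by
  obtain ⟨hd, C, hC⟩ := hd
  obtain ⟨hr, C', hC'⟩ := hr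
  have hC0 : 0 ≤ C := (norm_nonneg _).trans (hC 0)
  have hC0' : 0 ≤ C' := (norm_nonneg _).trans (hC' 0)
  obtain ⟨S, hSn, hS, -⟩ := exists_mul_operator hd hC0 hC
  obtain ⟨S', hSn', hS', -⟩ := exists_mul_operator hr hC0' hC'
  -- One summand for each of the three lower order terms, using `1/‖z‖ ≤ 1/√‖z‖` for `‖z‖ ≥ 1`.
  refine ⟨|c| * (4 + 2 / ε) + 2 / ε * C + 4 * C', by positivity, fun z hz hz1 ↦ ?_⟩
  have hz0 : 0 < ‖z‖ := by linarith
  have hs0 : 0 < √‖z‖ := Real.sqrt_pos.2 hz0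
  have hsz : √‖z‖ ≤ ‖z‖ := by
    rw [Real.sqrt_le_left hz0.le]
    nlinarith
  have hg := hasTemperateGrowth_resolventSymbol (ε := ε) hz hz0
  have hD := hasTemperateGrowth_dsymbol
  obtain ⟨G, hGn, hG⟩ := exists_fourierMultiplier_operator hg (by positivity)
    (norm_resolventSymbol_le hz hz0)
  obtain ⟨G₁, hGn₁, hG₁⟩ := exists_fourierMultiplier_operator (hD.mul hg)
    (C := 4 / ‖z‖ + 2 / (ε * √‖z‖)) (by positivity) fun ξ ↦ by
      rw [Pi.mul_apply, norm_mul]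
      exact norm_dsymbol_mul_resolventSymbol_le hε hz hz0 ξ
  obtain ⟨G₂, hGn₂, hG₂⟩ := exists_fourierMultiplier_operator ((hD.mul hD).mul hg)
    (C := 2 / (ε * √‖z‖)) (by positivity) fun ξ ↦ by
      rw [Pi.mul_apply, Pi.mul_apply, norm_mul, norm_mul, ← sq]
      exact norm_dsymbol_sq_mul_resolventSymbol_le hε hz hz0 ξ
  -- The derivatives are absorbed into the multipliers `G₁` and `G₂`, so `B` is defined on all of
  -- `L²`.
  refine ⟨G, (c : ℂ) • G₁ + G₂ ∘L S + G ∘L S', hGn, ?_, hG, fun u ↦ ?_⟩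
  · have h4 : 4 / ‖z‖ ≤ 4 / √‖z‖ := by gcongr
    have h2 : 2 / (ε * √‖z‖) = 2 / ε / √‖z‖ := by rw [div_div]
    have e1 : ‖(c : ℂ) • G₁‖ ≤ |c| * (4 / √‖z‖ + 2 / ε / √‖z‖) := by
      rw [norm_smul, Complex.norm_real, Real.norm_eq_abs]
      refine mul_le_mul_of_nonneg_left ?_ (abs_nonneg c)
      linarith
    have e2 : ‖G₂ ∘L S‖ ≤ 2 / ε / √‖z‖ * C :=
      (G₂.opNorm_comp_le S).trans
        (mul_le_mul (hGn₂.trans h2.le) hSn (norm_nonneg _) (by positivity))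
    have e3 : ‖G ∘L S'‖ ≤ 4 / √‖z‖ * C' :=
      (G.opNorm_comp_le S').trans (mul_le_mul (hGn.trans h4) hSn' (norm_nonneg _) (by positivity))
    refine (norm_add₃_le).trans ((add_le_add (add_le_add e1 e2) e3).trans (le_of_eq ?_))
    field_simp
  · have e : toDist (((c : ℂ) • G₁ + G₂ ∘L S + G ∘L S') u) =
        (c : ℂ) • toDist (G₁ u) + toDist (G₂ (S u)) + toDist (G (S' u)) := by
      change Lp.toTemperedDistributionCLM ℂ volume 2 ((c : ℂ) • G₁ u + G₂ (S u) + G (S' u)) = _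
      rw [map_add, map_add, map_smul]
    rw [e, hG, hG₁, hG₂, hS, hS', lowerPart, map_add, map_add, map_smul]
    simp only [ddx_eq_fourierMultiplier]
    rw [fourierMultiplierCLM_fourierMultiplierCLM_apply hD hD,
      fourierMultiplierCLM_fourierMultiplierCLM_apply (hD.mul hD) hg,
      fourierMultiplierCLM_fourierMultiplierCLM_apply hD hg]

end Sobolev

/-! ### General facts on unbounded operators -/

section Resolvent

variable {X : Type*} [NormedAddCommGroup X] [NormedSpace ℂ X] {T : X →ₗ.[ℂ] X} {z : ℂ}
  {S : X →L[ℂ] X}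

theorem isResolventAt_iff_graph :
    IsResolventAt T z S ↔ (∀ f, (S f, z • S f - f) ∈ T.graph) ∧
      ∀ u g, (u, g) ∈ T.graph → S (z • u - g) = u := by
  constructor
  · rintro ⟨h1, h2⟩
    refine ⟨fun f ↦ ?_, fun u g hug ↦ ?_⟩
    · obtain ⟨h, hf⟩ := h1 f
      refine (LinearPMap.mem_graph_iff T).2 ⟨⟨S f, h⟩, rfl, ?_⟩
      exact (sub_sub_self (z • S f) _).symm.trans (congrArg (z • S f - ·) hf)
    · obtain ⟨y, rfl, rfl⟩ := (LinearPMap.mem_graph_iff T).1 hug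
      exact h2 y
  · rintro ⟨h1, h2⟩
    refine ⟨fun f ↦ ?_, fun u ↦ h2 u (T u) (T.mem_graph u)⟩
    obtain ⟨y, hy, hy'⟩ := (LinearPMap.mem_graph_iff T).1 (h1 f)
    simp only at hy hy'
    have hS : S f ∈ T.domain := hy ▸ y.2
    have : y = ⟨S f, hS⟩ := Subtype.ext hy
    refine ⟨hS, ?_⟩
    rw [← this, hy']
    simp

/-- An unbounded operator with non-empty resolvent set is closed. -/
theorem IsResolventAt.isClosed (h : IsResolventAt T z S) : T.IsClosed := by
  obtain ⟨h1, h2⟩ := isResolventAt_iff_graph.1 h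
  -- The graph is the set where two continuous maps agree.
  have hT : (T.graph : Set (X × X)) = {p | S (z • p.1 - p.2) = p.1} := by
    ext ⟨u, g⟩
    refine ⟨fun hp ↦ h2 u g hp, fun hp ↦ ?_⟩
    have := h1 (z • u - g)
    rw [show S (z • u - g) = u from hp] at this
    simpa using this
  change IsClosed (T.graph : Set (X × X))
  rw [hT]
  exact isClosed_eq (by fun_prop) (by fun_prop)

end Resolvent

/-! ### The resolvent of the linearised operator -/

section Wave

variable {ε c : ℝ} {U W P V : ℝ → ℝ}

theorem IsHeteroclinicWave.exists_resolvent (hε : 0 < ε) (h : IsHeteroclinicWave ε c U W P V) :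
    ∃ M : ℝ, 0 < M ∧ ∀ z : ℂ, -z.re ≤ |z.im| → M < ‖z‖ →
      ∃ S : L2 →L[ℂ] L2, IsResolventAt (linearisedOperator ε c U) z S ∧ ‖S‖ ≤ 8 / ‖z‖ := by
  obtain ⟨⟨d₁, d₂, hd, hd₁, hd₂, hder, hder₁⟩, hr⟩ := h.coefficients
  obtain ⟨N, hN, hres⟩ := exists_resolvent_lowerPart (c := c) hε hd hr
  -- Beyond `(2N)²` one has `N/√‖z‖ ≤ 1/2`, so `1 - B` is invertible.
  refine ⟨max 1 ((2 * N) ^ 2), by positivity, fun z hz hzM ↦ ?_⟩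
  have hz1 : 1 ≤ ‖z‖ := (le_max_left _ _).trans hzM.le
  have hz0 : 0 < ‖z‖ := by linarith
  have hs0 : 0 < √‖z‖ := Real.sqrt_pos.2 hz0
  obtain ⟨G, B, hGn, hBn, hG, hB⟩ := hres z hz hz1
  have hB2 : ‖B‖ ≤ 1 / 2 := by
    refine hBn.trans ?_
    rw [div_le_iff₀ hs0]
    have := Real.le_sqrt_of_sq_le ((le_max_right _ _).trans hzM.le)
    linarith
  set E := Units.oneSub B (hB2.trans_lt (by norm_num))
  have hE (u : L2) : (E : L2 →L[ℂ] L2) u = u - B u := rfl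
  have hE1 (u : L2) : (E : L2 →L[ℂ] L2) ((↑E⁻¹ : L2 →L[ℂ] L2) u) = u := by
    rw [← mul_apply_eq_comp, E.mul_inv]; rfl
  have hE2 (u : L2) : (↑E⁻¹ : L2 →L[ℂ] L2) ((E : L2 →L[ℂ] L2) u) = u := by
    rw [← mul_apply_eq_comp, E.inv_mul]; rfl
  set S : L2 →L[ℂ] L2 := (↑E⁻¹ : L2 →L[ℂ] L2) ∘L G
  have hS (f : L2) : S f = B (S f) + G f := by
    have := hE1 (G f)
    rw [hE] at this
    exact (sub_eq_iff_eq_add'.1 this)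
  refine ⟨S, isResolventAt_iff_graph.2 ⟨fun f ↦ ?_, fun u g hug ↦ ?_⟩, ?_⟩
  · rw [linearisedOperator_graph, mem_linearisedGraph_iff hd hr]
    set u := S f
    have hu : toDist u = fourierMultiplierCLM ℂ (resolventSymbol ε z)
        (lowerPart c (fun ζ ↦ (diffusion (U ζ) : ℂ))
          (fun ζ ↦ ((deriv reaction (U ζ) : ℝ) : ℂ)) (toDist u) + toDist f) := by
      rw [map_add, ← hB, ← hG, ← map_add, ← hS f]
    -- Bootstrap: `u ∈ L²` puts the lower order part in `H⁻²`, and `G` gains four derivatives, so `u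
    -- ∈ H²`. Then the lower order part is in `L²`, and a second pass gives `u ∈ H⁴`.
    have hu2 : MemSobolev 2 2 (toDist u) := by
      rw [hu]
      have := memSobolev_resolvent hε hz hz0
        ((memSobolev_neg_two_lowerPart (c := c) hd hr (memSobolev_zero_toDist u)).add
          ((memSobolev_zero_toDist f).mono (by norm_num)))
      norm_num at this
      exact this
    have hu4 : MemSobolev 4 2 (toDist u) := by
      rw [hu]
      have := memSobolev_resolvent hε hz hz0
        ((memSobolev_zero_lowerPart (c := c) hd hd₁ hd₂ hder hder₁ hr hu2).add
          (memSobolev_zero_toDist f))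
      rwa [add_zero] at this
    refine ⟨hu4, ?_⟩
    have key := leadingPart_resolvent (ε := ε) hz hz0 (lowerPart c (fun ζ ↦ (diffusion (U ζ) : ℂ))
          (fun ζ ↦ ((deriv reaction (U ζ) : ℝ) : ℂ)) (toDist u) + toDist f)
    rw [← hu] at key
    have e : toDist (z • u - f) = z • toDist u - toDist f := by
      rw [toDist, map_sub, map_smul]
    rw [e, sub_eq_sub_iff_add_eq_add, key]
  · rw [linearisedOperator_graph, mem_linearisedGraph_iff hd hr] at hug
    obtain ⟨-, hg⟩ := hug
    have e : toDist (z • u - g) = (z • toDist u + (ε ^ 2 : ℂ) • ddx (ddx (ddx (ddx (toDist u)))))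
        - lowerPart c (fun ζ ↦ (diffusion (U ζ) : ℂ))
          (fun ζ ↦ ((deriv reaction (U ζ) : ℝ) : ℂ)) (toDist u) := by
      rw [toDist, map_sub, map_smul]
      change z • toDist u - toDist g = _
      rw [hg]
      abel
    have hGu : G (z • u - g) = u - B u := by
      apply toDist_injective
      rw [hG, e, map_sub, resolvent_leadingPart hz hz0, ← hB, ← map_sub]
    change (↑E⁻¹ : L2 →L[ℂ] L2) (G (z • u - g)) = u
    rw [hGu, ← hE, hE2]
  · refine ContinuousLinearMap.opNorm_le_bound _ (by positivity) fun f ↦ ?_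
    -- Absorbing the first term on the left doubles `4/‖z‖` to `8/‖z‖`.
    have h1 : ‖S f‖ ≤ 1 / 2 * ‖S f‖ + 4 / ‖z‖ * ‖f‖ := by
      calc ‖S f‖ = ‖B (S f) + G f‖ := by rw [← hS f]
        _ ≤ ‖B (S f)‖ + ‖G f‖ := norm_add_le _ _
        _ ≤ _ := add_le_add (B.le_of_opNorm_le hB2 _) (G.le_of_opNorm_le hGn _)
    have h2 : 8 / ‖z‖ * ‖f‖ = 2 * (4 / ‖z‖ * ‖f‖) := by ring
    linarith

/-- Schwartz functions are dense in `L²` and lie in the domain, since the smooth coefficients keep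
the image in `L²`. -/
theorem IsHeteroclinicWave.dense_domain (h : IsHeteroclinicWave ε c U W P V) :
    Dense ((linearisedOperator ε c U).domain : Set L2) := by
  obtain ⟨⟨d₁, d₂, hd, hd₁, hd₂, hder, hder₁⟩, hr⟩ := h.coefficients
  refine Dense.mono ?_ (SchwartzMap.denseRange_toLpCLM (E := ℝ) (F := ℂ) (p := 2)
    (μ := volume) ENNReal.ofNat_ne_top)
  rintro _ ⟨φ, rfl⟩
  set u : L2 := SchwartzMap.toLpCLM ℝ ℂ 2 volume φ
  have hu (s : ℝ) : MemSobolev s 2 (toDist u) := by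
    have : toDist u = φ := Lp.toTemperedDistribution_toLp_eq φ
    rw [this]
    exact φ.memSobolev
  have h4 := memSobolev_ddx (memSobolev_ddx (memSobolev_ddx (memSobolev_ddx (hu 4))))
  norm_num at h4
  obtain ⟨f, hf⟩ := memSobolev_zero_iff.1
    ((memSobolev_zero_lowerPart (c := c) hd hd₁ hd₂ hder hder₁ hr (hu 2)).sub
      (h4.smul (ε ^ 2 : ℂ)))
  refine (LinearPMap.mem_domain_iff).2 ⟨f, ?_⟩
  rw [linearisedOperator_graph, mem_linearisedGraph_iff hd hr]
  exact ⟨hu 4, hf.symm⟩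

end Wave

/-! ### Sectors -/

theorem neg_re_le_abs_im_of_abs_arg_le {z : ℂ} (h : |z.arg| ≤ Real.pi - Real.pi / 4) :
    -z.re ≤ |z.im| := by
  rw [← Complex.norm_mul_cos_arg z, ← Complex.norm_mul_sin_arg z, abs_mul, abs_norm, ← mul_neg]
  refine mul_le_mul_of_nonneg_left ?_ (norm_nonneg z)
  rw [Real.abs_sin_eq_sin_abs_of_abs_le_pi (Complex.abs_arg_le_pi z), ← Real.cos_abs,
    ← Real.cos_pi_sub, ← Real.cos_sub_pi_div_two, ← Real.cos_abs (|z.arg| - Real.pi / 2)]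
  -- With `θ = |arg z|`, the claim is now `cos (π - θ) ≤ cos |θ - π/2|`; it follows from `|θ - π/2|
  -- ≤ π - θ`, that is, `θ ≤ 3π/4`.
  refine Real.cos_le_cos_of_nonneg_of_le_pi (abs_nonneg _) ?_ ?_
  · linarith [abs_nonneg z.arg]
  · rw [abs_le]
    constructor <;> linarith [Real.pi_pos]

/-- If `w = z - 4M` is nonzero and in the sector, then so is `z`, and `‖z‖ ≥ (‖w‖ + 4M)/4`. Hence
`‖z‖ > M`, and `8/‖z‖ ≤ 32/‖w‖`. -/
theorem IsHeteroclinicWave.isSectorial {ε c : ℝ} {U W P V : ℝ → ℝ} (hε : 0 < ε)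
    (h : IsHeteroclinicWave ε c U W P V) : IsSectorial (linearisedOperator ε c U) := by
  obtain ⟨M, hM, hres⟩ := h.exists_resolvent hε
  refine ⟨?_, h.dense_domain, 4 * M, Real.pi / 4, 32, by positivity,
    by linarith [Real.pi_pos], by norm_num, fun z hz hza ↦ ?_⟩
  · obtain ⟨S, hS, -⟩ := hres ((M + 1 : ℝ) : ℂ)
      (by rw [Complex.ofReal_re, Complex.ofReal_im, abs_zero]; linarith)
      (by rw [Complex.norm_real, Real.norm_of_nonneg (by linarith)]; linarith)
    exact hS.isClosed
  · have hw := neg_re_le_abs_im_of_abs_arg_le hza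
    have hw0 : 0 < ‖z - ((4 * M : ℝ) : ℂ)‖ := norm_pos_iff.2 (sub_ne_zero.2 hz)
    have h1 := norm_add_ge_of_sector hw (t := 4 * M) (by positivity)
    rw [sub_add_cancel] at h1
    simp only [Complex.sub_re, Complex.sub_im, Complex.ofReal_re, Complex.ofReal_im,
      sub_zero] at hw
    obtain ⟨S, hS, hSn⟩ := hres z (by linarith) (by linarith)
    refine ⟨S, hS, hSn.trans ?_⟩
    rw [div_le_div_iff₀ (by linarith) hw0]
    linarith

end ShockWave

/-- Spectral sector estimate for, and sectoriality of, the linearisation about the travelling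
wave. -/
theorem mainTheorem1 (ε c : ℝ) (hε : 0 < ε) (U W P V : ℝ → ℝ)
    (hwave : ShockWave.IsHeteroclinicWave ε c U W P V) :
    (∃ M γ : ℝ, 0 < M ∧ 0 < γ ∧ γ < Real.pi / 2 ∧
      ∀ z : ℂ, M < ‖z‖ → |z.arg| < Real.pi - γ →
        z ∉ ShockWave.opSpectrum (ShockWave.linearisedOperator ε c U)) ∧
    ShockWave.IsSectorial (ShockWave.linearisedOperator ε c U) := by
  refine ⟨?_, hwave.isSectorial hε⟩
  obtain ⟨M, hM, hres⟩ := hwave.exists_resolvent hε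
  refine ⟨M, Real.pi / 4, hM, by positivity, by linarith [Real.pi_pos], fun z hz harg hspec ↦ ?_⟩
  obtain ⟨S, hS, -⟩ := hres z (ShockWave.neg_re_le_abs_im_of_abs_arg_le harg.le) hz
  exact hspec ⟨S, hS⟩
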